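/- Let $A_0,A_1,\dots,A_p\in\mathbb{R}^{n\times n}$ and $B\in\mathbb{R}^{n\times m}$, let $\mathcal{P}\subset\mathbb{R}^p$ be a nonempty polytope (the convex hull of finitely many points), and put $A(\rho)=A_0+\sum_{i=1}^p\rho_iA_i$. Let $R\in\mathbb{R}^{m\times m}$ be symmetric positive definite and $Q\in\mathbb{R}^{n\times n}$ symmetric positive semidefinite. Assume that for every $\rho\in\mathcal{P}$ the pair $(A(\rho),B)$ is stabilizable (there is $K$ such that all eigenvalues of $A(\rho)-BK$ have negative real part) and the pair $(A(\rho),\sqrt{Q})$ is detectable (there is $L$ such that all eigenvalues of $A(\rho)-L\sqrt{Q}$ have negative real part), where $\sqrt{Q}$ is the positive semidefinite square root of $Q$. Then for every $\rho\in\mathcal{P}$ the algebraic Riccati equation $$A(\rho)^\top P+PA(\rho)-PBR^{-1}B^\top P+Q=0$$ has exactly one positive semidefinite solution $P^*(\rho)$, and $P^*(\rho)-X$ is positive semidefinite for every symmetric solution $X$. Let $K^*_\rho=R^{-1}B^\top P^*(\rho)$ be the optimal LQR gain. The map $\rho\mapsto K^*_\rho$ is continuous on $\mathcal{P}$, and the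 set $\mathcal{K}^*=\{K^*_\rho:\rho\in\mathcal{P}\}\subset\mathbb{R}^{m\times n}$ is compact and path-connected. -/

import Mathlib

open scoped Matrix MatrixOrder

noncomputable section

namespace LQR

/-- A polytope: the convex hull of finitely many points (such a set is convex and compact). -/
def IsPolytope {E : Type*} [AddCommGroup E] [Module ℝ E] (S : Set E) : Prop :=
  ∃ V : Set E, V.Finite ∧ S = convexHull ℝ V

/-- Hurwitz matrix: all complex eigenvalues have strictly negative real part. -/
def IsHurwitz {n : ℕ} (A : Matrix (Fin n) (Fin n) ℝ) : Prop :=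
  ∀ z ∈ spectrum ℂ (A.map (algebraMap ℝ ℂ)), z.re < 0

/-- `(A, B)` is stabilizable: some state feedback makes `A - B K` Hurwitz. -/
def Stabilizable {n m : ℕ} (A : Matrix (Fin n) (Fin n) ℝ) (B : Matrix (Fin n) (Fin m) ℝ) : Prop :=
  ∃ K : Matrix (Fin m) (Fin n) ℝ, IsHurwitz (A - B * K)

/-- `(A, C)` is detectable: some output injection makes `A - L C` Hurwitz. -/
def Detectable {n q : ℕ} (A : Matrix (Fin n) (Fin n) ℝ) (C : Matrix (Fin q) (Fin n) ℝ) : Prop :=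
  ∃ L : Matrix (Fin n) (Fin q) ℝ, IsHurwitz (A - L * C)

/-- The affine parameter dependence `A(ρ) = A₀ + ∑ᵢ ρᵢ Aᵢ`. -/
def systemMatrix {n p : ℕ} (A₀ : Matrix (Fin n) (Fin n) ℝ)
    (A₁ : Fin p → Matrix (Fin n) (Fin n) ℝ) (ρ : EuclideanSpace ℝ (Fin p)) :
    Matrix (Fin n) (Fin n) ℝ :=
  A₀ + ∑ i, ρ i • A₁ i

/-- `P` solves the continuous-time algebraic Riccati equation
`Aᵀ P + P A - P B R⁻¹ Bᵀ P + Q = 0`. -/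
def SolvesCARE {n m : ℕ} (A : Matrix (Fin n) (Fin n) ℝ) (B : Matrix (Fin n) (Fin m) ℝ)
    (Q : Matrix (Fin n) (Fin n) ℝ) (R : Matrix (Fin m) (Fin m) ℝ)
    (P : Matrix (Fin n) (Fin n) ℝ) : Prop :=
  Aᵀ * P + P * A - P * B * R⁻¹ * Bᵀ * P + Q = 0

open Classical in
/-- `P*`: the positive semidefinite solution of the Riccati equation
(the value `0` is used if there is none). -/
def careSolution {n m : ℕ} (A : Matrix (Fin n) (Fin n) ℝ) (B : Matrix (Fin n) (Fin m) ℝ)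
    (Q : Matrix (Fin n) (Fin n) ℝ) (R : Matrix (Fin m) (Fin m) ℝ) :
    Matrix (Fin n) (Fin n) ℝ :=
  if h : ∃ P : Matrix (Fin n) (Fin n) ℝ, P.PosSemidef ∧ SolvesCARE A B Q R P
  then h.choose else 0

/-- The optimal LQR gain `K* = R⁻¹ Bᵀ P*`. -/
def optimalGain {n m : ℕ} (A : Matrix (Fin n) (Fin n) ℝ) (B : Matrix (Fin n) (Fin m) ℝ)
    (Q : Matrix (Fin n) (Fin n) ℝ) (R : Matrix (Fin m) (Fin m) ℝ) :
    Matrix (Fin m) (Fin n) ℝ :=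
  R⁻¹ * Bᵀ * careSolution A B Q R

end LQR

end

/-! The engine is the Lyapunov operator X ↦ FᵀX + XF of a Hurwitz F. The Cayley transform turns it
into a Stein operator X - MᵀXM with Mᵏ → 0, so uniqueness, positivity and existence follow by
telescoping and finite-dimensional linear algebra, with no matrix exponential. Completing the square
(`lyapunov_eq_riccati_add_sq`) makes the Lyapunov equation of any gain K the Riccati expression plus
a positive semidefinite square. Policy iteration from a stabilizing gain then decreases to a
positive semidefinite solution. Detectability makes every such solution stabilizing
(`isHurwitz_of_lyapunov`), hence maximal, hence unique. For continuity, a strict Lyapunov inequality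
for one fixed gain survives small changes of A and bounds all nearby solutions. They stay in a
compact set, and each cluster point is a positive semidefinite solution at the limit, so it is P*.
Compactness and path-connectedness pass to the image of the polytope. -/

open Filter Topology

/-! ### Spectra and powers of real matrices. -/

/-- Powers of an element of spectral radius less than one tend to zero. -/
theorem tendsto_pow_zero_of_spectralRadius_lt_one {A : Type*} [NormedRing A] [NormedAlgebra ℂ A]
    [CompleteSpace A] {a : A} (h : spectralRadius ℂ a < 1) :
    Tendsto (fun k : ℕ => a ^ k) atTop (𝓝 0) := by
  obtain ⟨r, har, hr⟩ := ENNReal.lt_iff_exists_nnreal_btwn.1 h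
  -- Gelfand's formula: eventually ‖aᵏ‖ ≤ rᵏ with r < 1.
  have hev := (spectrum.pow_nnnorm_pow_one_div_tendsto_nhds_spectralRadius a).eventually_lt_const har
  have hr1 : r < 1 := by exact_mod_cast hr
  refine squeeze_zero_norm' ?_ (tendsto_pow_atTop_nhds_zero_of_lt_one r.coe_nonneg
    (by exact_mod_cast hr1))
  filter_upwards [hev, eventually_gt_atTop 0] with k hk hk0
  have hk0' : (0 : ℝ) < k := by exact_mod_cast hk0
  have h1 : ((‖a ^ k‖₊ : ENNReal)) ≤ (r : ENNReal) ^ k := by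
    have := ENNReal.rpow_le_rpow hk.le hk0'.le
    rwa [← ENNReal.rpow_mul, one_div, inv_mul_cancel₀ hk0'.ne', ENNReal.rpow_one,
      ENNReal.rpow_natCast] at this
  have h2 : ‖a ^ k‖₊ ≤ r ^ k := by exact_mod_cast h1
  exact_mod_cast h2

namespace Matrix

section
attribute [local instance] Matrix.linftyOpNormedRing Matrix.linftyOpNormedAlgebra

/-- Powers of a complex matrix all of whose eigenvalues lie in the open unit disc tend to zero. -/
theorem tendsto_pow_zero_of_spectrum_lt_one {n : ℕ} {M : Matrix (Fin n) (Fin n) ℂ}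
    (h : ∀ z ∈ spectrum ℂ M, ‖z‖ < 1) : Tendsto (fun k : ℕ => M ^ k) atTop (𝓝 0) := by
  cases n with
  | zero => exact tendsto_const_nhds.congr fun k => Subsingleton.elim _ _
  | succ n =>
    have : CompleteSpace (Matrix (Fin (n + 1)) (Fin (n + 1)) ℂ) := FiniteDimensional.complete ℂ _
    refine tendsto_pow_zero_of_spectralRadius_lt_one ?_
    exact_mod_cast spectrum.spectralRadius_lt_of_forall_lt M (r := 1) fun z hz => by
      exact_mod_cast h z hz

end

/-- Powers of a real matrix all of whose complex eigenvalues lie in the open unit disc tend to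
zero. -/
theorem tendsto_pow_zero_of_spectrum_map_lt_one {n : ℕ} {M : Matrix (Fin n) (Fin n) ℝ}
    (h : ∀ z ∈ spectrum ℂ (M.map (algebraMap ℝ ℂ)), ‖z‖ < 1) :
    Tendsto (fun k : ℕ => M ^ k) atTop (𝓝 0) := by
  have h1 := tendsto_pow_zero_of_spectrum_lt_one h
  have h2 : Continuous fun N : Matrix (Fin n) (Fin n) ℂ => N.map Complex.re :=
    continuous_id.matrix_map Complex.continuous_re
  have h3 := (h2.tendsto 0).comp h1
  have h0 : (0 : Matrix (Fin n) (Fin n) ℂ).map Complex.re = 0 := by ext; simp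
  rw [h0] at h3
  refine h3.congr fun k => ?_
  have : M.map (algebraMap ℝ ℂ) ^ k = (M ^ k).map (algebraMap ℝ ℂ) :=
    (map_pow (algebraMap ℝ ℂ).mapMatrix M k).symm
  simp only [Function.comp, this]
  ext; simp

/-- The eigenvalue condition for a complex number and a real matrix, in real coordinates. -/
theorem mem_spectrum_map_iff {n : ℕ} {M : Matrix (Fin n) (Fin n) ℝ} {z : ℂ} :
    z ∈ spectrum ℂ (M.map (algebraMap ℝ ℂ)) ↔
      ∃ a b : Fin n → ℝ, ¬ (a = 0 ∧ b = 0) ∧ M *ᵥ a = z.re • a - z.im • b ∧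
        M *ᵥ b = z.im • a + z.re • b := by
  rw [← Matrix.spectrum_toLin', ← Module.End.hasEigenvalue_iff_mem_spectrum]
  have key : ∀ v : Fin n → ℂ, M.map (algebraMap ℝ ℂ) *ᵥ v = z • v ↔
      (M *ᵥ (fun i => (v i).re) = z.re • (fun i => (v i).re) - z.im • (fun i => (v i).im) ∧
      M *ᵥ (fun i => (v i).im) = z.im • (fun i => (v i).re) + z.re • (fun i => (v i).im)) := by
    intro v
    simp only [funext_iff, Complex.ext_iff, ← forall_and]
    refine forall_congr' fun i => ?_
    simp only [mulVec, dotProduct, Complex.re_sum, Complex.im_sum]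
    simp [add_comm]
  constructor
  · intro h
    obtain ⟨v, hv⟩ := h.exists_hasEigenvector
    have h1 := (key v).1 (by simpa using hv.apply_eq_smul)
    refine ⟨_, _, fun h => hv.2 ?_, h1⟩
    ext i
    exact Complex.ext (congrFun h.1 i) (congrFun h.2 i)
  · rintro ⟨a, b, hab, h⟩
    have h1 := (key fun i => ⟨a i, b i⟩).2 h
    refine Module.End.hasEigenvalue_of_hasEigenvector (x := fun i => ⟨a i, b i⟩)
      ⟨by simpa using h1, fun h0 => hab ⟨?_, ?_⟩⟩
    · ext i; exact congrArg Complex.re (congrFun h0 i)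
    · ext i; exact congrArg Complex.im (congrFun h0 i)

end Matrix

namespace LQR

open Matrix

/-- An eigenvector a + ib is split into real parts, so that real quadratic forms can be applied to
it. -/
theorem isHurwitz_iff {n : ℕ} {F : Matrix (Fin n) (Fin n) ℝ} :
    IsHurwitz F ↔ ∀ (α β : ℝ) (a b : Fin n → ℝ), F *ᵥ a = α • a - β • b →
      F *ᵥ b = β • a + α • b → 0 ≤ α → a = 0 ∧ b = 0 := by
  simp only [IsHurwitz, mem_spectrum_map_iff]
  constructor
  · intro h α β a b ha hb hα
    by_contra hab
    exact absurd (h ⟨α, β⟩ ⟨a, b, hab, ha, hb⟩) (not_lt.2 hα)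
  · rintro h z ⟨a, b, hab, ha, hb⟩
    by_contra hz
    exact hab (h _ _ a b ha hb (not_lt.1 hz))

end LQR

/-! ### Positive semidefinite matrices and the Stein equation. -/

namespace Matrix

theorem posSemidef_iff_real {n : ℕ} {X : Matrix (Fin n) (Fin n) ℝ} :
    X.PosSemidef ↔ Xᵀ = X ∧ ∀ x, 0 ≤ x ⬝ᵥ X *ᵥ x := by
  rw [posSemidef_iff_dotProduct_mulVec]
  simp [IsHermitian, conjTranspose_eq_transpose_of_trivial]

theorem PosSemidef.transpose_mul_mul_same {n m : ℕ} {X : Matrix (Fin n) (Fin n) ℝ}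
    (hX : X.PosSemidef) (C : Matrix (Fin n) (Fin m) ℝ) : (Cᵀ * X * C).PosSemidef := by
  simpa [conjTranspose_eq_transpose_of_trivial] using hX.conjTranspose_mul_mul_same C

theorem isClosed_setOf_posSemidef {n : ℕ} :
    IsClosed {X : Matrix (Fin n) (Fin n) ℝ | X.PosSemidef} := by
  simp only [posSemidef_iff_real, Set.ofPred_and, Set.ofPred_forall]
  refine (isClosed_eq (by fun_prop) (by fun_prop)).inter (isClosed_iInter fun x => ?_)
  exact isClosed_le continuous_const (by fun_prop)

/-- If the powers of `M` tend to zero and `X - Mᵀ X M` is positive semidefinite, so is `X`. -/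
theorem posSemidef_of_stein {n : ℕ} {M X : Matrix (Fin n) (Fin n) ℝ}
    (hM : Tendsto (fun k : ℕ => M ^ k) atTop (𝓝 0)) (h : (X - Mᵀ * X * M).PosSemidef) :
    X.PosSemidef := by
  -- Telescoping: the difference is a sum of conjugates of X - MᵀXM.
  have hk : ∀ k : ℕ, (X - (M ^ k)ᵀ * X * M ^ k).PosSemidef := by
    intro k
    induction k with
    | zero => simpa using PosSemidef.zero
    | succ k ih =>
      have := ih.add (h.transpose_mul_mul_same (M ^ k))
      convert this using 1
      rw [pow_succ', transpose_mul]
      noncomm_ring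
  have hc : Continuous fun N : Matrix (Fin n) (Fin n) ℝ => X - Nᵀ * X * N := by fun_prop
  have hl := (hc.tendsto 0).comp hM
  simp only [mul_zero, sub_zero] at hl
  exact isClosed_setOf_posSemidef.mem_of_tendsto hl (Eventually.of_forall hk)

/-- If the powers of `M` tend to zero, the homogeneous Stein equation has only the zero solution. -/
theorem eq_zero_of_stein {n : ℕ} {M X : Matrix (Fin n) (Fin n) ℝ}
    (hM : Tendsto (fun k : ℕ => M ^ k) atTop (𝓝 0)) (h : X = Mᵀ * X * M) : X = 0 := by
  have hk : ∀ k : ℕ, X = (M ^ k)ᵀ * X * M ^ k := by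
    intro k
    induction k with
    | zero => simp
    | succ k ih =>
      calc X = (M ^ k)ᵀ * (Mᵀ * X * M) * M ^ k := by rw [← h]; exact ih
        _ = _ := by rw [pow_succ', transpose_mul]; noncomm_ring
  have hc : Continuous fun N : Matrix (Fin n) (Fin n) ℝ => Nᵀ * X * N := by fun_prop
  have hl := (hc.tendsto 0).comp hM
  simp only [mul_zero] at hl
  exact tendsto_nhds_unique (tendsto_const_nhds.congr hk) hl

end Matrix

/-! ### Cayley transform and Lyapunov equation. -/

namespace LQR

open Matrix

variable {n : ℕ} {F : Matrix (Fin n) (Fin n) ℝ}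

theorem IsHurwitz.isUnit_det_sub_one (hF : IsHurwitz F) : IsUnit (F - 1).det := by
  rw [isUnit_iff_ne_zero]
  intro h
  obtain ⟨v, hv, h⟩ := exists_mulVec_eq_zero_iff.2 h
  rw [sub_mulVec, one_mulVec, sub_eq_zero] at h
  exact hv (isHurwitz_iff.1 hF 1 0 v 0 (by simpa using h) (by simp) zero_le_one).1

/-- The Cayley transform `(F + 1)(F - 1)⁻¹`. -/
noncomputable def cayley (F : Matrix (Fin n) (Fin n) ℝ) : Matrix (Fin n) (Fin n) ℝ := (F + 1) * (F - 1)⁻¹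

/-- The eigenvalues of the Cayley transform of a Hurwitz matrix lie in the open unit disc. -/
theorem IsHurwitz.norm_lt_one_of_mem_spectrum_cayley (hF : IsHurwitz F) {z : ℂ}
    (hz : z ∈ spectrum ℂ ((cayley F).map (algebraMap ℝ ℂ))) : ‖z‖ < 1 := by
  obtain ⟨a, b, hab, ha, hb⟩ := mem_spectrum_map_iff.1 hz
  obtain ⟨x, y⟩ := z
  simp only at ha hb
  have hu := hF.isUnit_det_sub_one
  set a' := (F - 1)⁻¹ *ᵥ a with ha'
  set b' := (F - 1)⁻¹ *ᵥ b with hb'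
  have haa : a = (F - 1) *ᵥ a' := by rw [ha', mulVec_mulVec, mul_nonsing_inv _ hu, one_mulVec]
  have hbb : b = (F - 1) *ᵥ b' := by rw [hb', mulVec_mulVec, mul_nonsing_inv _ hu, one_mulVec]
  rw [cayley, ← mulVec_mulVec, ← ha', haa, hbb] at ha
  rw [cayley, ← mulVec_mulVec, ← hb', haa, hbb] at hb
  simp only [add_mulVec, sub_mulVec, one_mulVec] at ha hb
  by_contra hlt
  have hxy : 1 ≤ x ^ 2 + y ^ 2 := by
    have h1 : (1 : ℝ) ≤ ‖(⟨x, y⟩ : ℂ)‖ ^ 2 := one_le_pow₀ (not_lt.1 hlt)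
    rw [Complex.sq_norm, Complex.normSq_mk] at h1
    linarith
  suffices a' = 0 ∧ b' = 0 from hab ⟨by rw [haa, this.1, mulVec_zero],
    by rw [hbb, this.2, mulVec_zero]⟩
  have hai : ∀ i, (F *ᵥ a') i + a' i = x * ((F *ᵥ a') i - a' i) - y * ((F *ᵥ b') i - b' i) :=
    fun i => by simpa using congrFun ha i
  have hbi : ∀ i, (F *ᵥ b') i + b' i = y * ((F *ᵥ a') i - a' i) + x * ((F *ᵥ b') i - b' i) :=
    fun i => by simpa using congrFun hb i
  -- For z = 1 the relation (F + 1)v = (F - 1)v forces v = 0. Otherwise v belongs to the eigenvalue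
  -- (z + 1)/(z - 1) of F, with real part (|z|² - 1)/|z - 1|² ≥ 0.
  by_cases hd : (1 - x) ^ 2 + y ^ 2 = 0
  · have hx : x = 1 := by nlinarith [sq_nonneg (1 - x), sq_nonneg y]
    have hy : y = 0 := by nlinarith [sq_nonneg (1 - x), sq_nonneg y]
    subst hx hy
    constructor <;> ext i
    · have := hai i; simp only [Pi.zero_apply]; linarith
    · have := hbi i; simp only [Pi.zero_apply]; linarith
  · refine isHurwitz_iff.1 hF ((x ^ 2 + y ^ 2 - 1) / ((1 - x) ^ 2 + y ^ 2))
      (-2 * y / ((1 - x) ^ 2 + y ^ 2)) a' b' ?_ ?_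
      (div_nonneg (by linarith) (by positivity))
    · ext i
      simp only [Pi.sub_apply, Pi.smul_apply, smul_eq_mul]
      field_simp
      linear_combination (1 - x) * hai i - y * hbi i
    · ext i
      simp only [Pi.add_apply, Pi.smul_apply, smul_eq_mul]
      field_simp
      linear_combination y * hai i + (1 - x) * hbi i

theorem IsHurwitz.tendsto_cayley_pow (hF : IsHurwitz F) :
    Tendsto (fun k : ℕ => cayley F ^ k) atTop (𝓝 0) :=
  tendsto_pow_zero_of_spectrum_map_lt_one fun _ hz => hF.norm_lt_one_of_mem_spectrum_cayley hz

/-- The Cayley transform turns the Lyapunov operator into the Stein operator. -/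
theorem IsHurwitz.sub_cayley (hF : IsHurwitz F) (X : Matrix (Fin n) (Fin n) ℝ) :
    X - (cayley F)ᵀ * X * cayley F =
      ((F - 1)⁻¹)ᵀ * ((2 : ℝ) • -(Fᵀ * X + X * F)) * (F - 1)⁻¹ := by
  have hu := hF.isUnit_det_sub_one
  have h1 : (F - 1) * (F - 1)⁻¹ = 1 := mul_nonsing_inv _ hu
  have h2 : ((F - 1)⁻¹)ᵀ * (F - 1)ᵀ = 1 := by rw [← transpose_mul, h1, transpose_one]
  have h3 : (2 : ℝ) • -(Fᵀ * X + X * F) = (F - 1)ᵀ * X * (F - 1) - (F + 1)ᵀ * X * (F + 1) := by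
    simp only [transpose_sub, transpose_add, transpose_one, two_smul]
    noncomm_ring
  rw [h3, cayley, transpose_mul, mul_sub, sub_mul]
  congr 1
  · calc X = (((F - 1)⁻¹)ᵀ * (F - 1)ᵀ) * X * ((F - 1) * (F - 1)⁻¹) := by
          rw [h1, h2, one_mul, mul_one]
      _ = _ := by simp only [mul_assoc]
  · simp only [mul_assoc]

/-- Lyapunov's theorem: a solution of a Lyapunov inequality for a Hurwitz matrix is positive
semidefinite. -/
theorem IsHurwitz.posSemidef_of_lyapunov (hF : IsHurwitz F) {X : Matrix (Fin n) (Fin n) ℝ}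
    (h : (-(Fᵀ * X + X * F)).PosSemidef) : X.PosSemidef := by
  refine posSemidef_of_stein hF.tendsto_cayley_pow ?_
  rw [hF.sub_cayley]
  exact (h.smul zero_le_two).transpose_mul_mul_same _

theorem IsHurwitz.eq_zero_of_lyapunov (hF : IsHurwitz F) {X : Matrix (Fin n) (Fin n) ℝ}
    (h : Fᵀ * X + X * F = 0) : X = 0 := by
  refine eq_zero_of_stein hF.tendsto_cayley_pow ?_
  rw [← sub_eq_zero, hF.sub_cayley, h]
  simp

/-- For a Hurwitz matrix the Lyapunov equation with positive semidefinite right-hand side has a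
positive semidefinite solution. -/
theorem IsHurwitz.exists_lyapunov (hF : IsHurwitz F) {W : Matrix (Fin n) (Fin n) ℝ}
    (hW : W.PosSemidef) :
    ∃ X : Matrix (Fin n) (Fin n) ℝ, X.PosSemidef ∧ Fᵀ * X + X * F + W = 0 := by
  let L : Matrix (Fin n) (Fin n) ℝ →ₗ[ℝ] Matrix (Fin n) (Fin n) ℝ :=
    LinearMap.mulLeft ℝ Fᵀ + LinearMap.mulRight ℝ F
  have hL : Function.Injective L := by
    rw [injective_iff_map_eq_zero]
    exact fun X hX => hF.eq_zero_of_lyapunov hX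
  obtain ⟨X, hX⟩ := LinearMap.surjective_of_injective hL (-W)
  have hX' : Fᵀ * X + X * F = -W := hX
  exact ⟨X, hF.posSemidef_of_lyapunov (by rwa [hX', neg_neg]), by rw [hX', neg_add_cancel]⟩

end LQR

/-! ### Order, limits and compactness for semidefinite matrices. -/

namespace Matrix

/-- A decreasing sequence of positive semidefinite matrices converges. -/
theorem exists_tendsto_of_posSemidef_sub_succ {n : ℕ} {X : ℕ → Matrix (Fin n) (Fin n) ℝ}
    (h0 : ∀ k, (X k).PosSemidef) (h : ∀ k, (X k - X (k + 1)).PosSemidef) :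
    ∃ P : Matrix (Fin n) (Fin n) ℝ, Tendsto X atTop (𝓝 P) := by
  have hq : ∀ x : Fin n → ℝ, ∃ q, Tendsto (fun k => x ⬝ᵥ X k *ᵥ x) atTop (𝓝 q) := by
    intro x
    have hanti : Antitone fun k => x ⬝ᵥ X k *ᵥ x := by
      refine antitone_nat_of_succ_le fun k => ?_
      have := (posSemidef_iff_real.1 (h k)).2 x
      rw [sub_mulVec, dotProduct_sub] at this
      linarith
    refine ⟨_, tendsto_atTop_ciInf hanti ⟨0, ?_⟩⟩
    rintro _ ⟨k, rfl⟩
    exact (posSemidef_iff_real.1 (h0 k)).2 x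
  choose q hq using hq
  -- Polarization recovers the entries from the limits of the quadratic forms.
  refine ⟨fun i j => (q (Pi.single i 1 + Pi.single j 1) - q (Pi.single i 1) - q (Pi.single j 1)) / 2,
    tendsto_pi_nhds.2 fun i => tendsto_pi_nhds.2 fun j => ?_⟩
  refine ((((hq (Pi.single i 1 + Pi.single j 1)).sub (hq (Pi.single i 1))).sub
    (hq (Pi.single j 1))).div_const 2).congr fun k => ?_
  have hs : X k j i = X k i j := congrFun (congrFun (posSemidef_iff_real.1 (h0 k)).1 i) j
  simp [mulVec_add, add_dotProduct, hs]
  ring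

/-- Evaluate the quadratic form at eᵢ ± eⱼ. -/
theorem PosSemidef.abs_apply_le {n : ℕ} {X : Matrix (Fin n) (Fin n) ℝ} (hX : X.PosSemidef)
    (i j : Fin n) : |X i j| ≤ (X i i + X j j) / 2 := by
  obtain ⟨hs, hq⟩ := posSemidef_iff_real.1 hX
  have hs : X j i = X i j := congrFun (congrFun hs i) j
  have h1 := hq (Pi.single i 1 + Pi.single j 1)
  have h2 := hq (Pi.single i 1 - Pi.single j 1)
  simp [mulVec_add, mulVec_sub, add_dotProduct, sub_dotProduct, hs] at h1 h2
  rw [abs_le]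
  constructor <;> linarith

/-- The order interval between zero and a matrix is contained in a compact set. -/
theorem exists_isCompact_of_posSemidef_le {n : ℕ} (Y : Matrix (Fin n) (Fin n) ℝ) :
    ∃ s : Set (Matrix (Fin n) (Fin n) ℝ), IsCompact s ∧
      ∀ X : Matrix (Fin n) (Fin n) ℝ, X.PosSemidef → (Y - X).PosSemidef → X ∈ s := by
  refine ⟨Set.univ.pi fun i => Set.univ.pi fun j =>
    Set.Icc (-((Y i i + Y j j) / 2)) ((Y i i + Y j j) / 2),
    isCompact_univ_pi fun i => isCompact_univ_pi fun j => isCompact_Icc, ?_⟩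
  intro X hX hYX i _ j _
  have h1 := hX.abs_apply_le i j
  have h2 := hYX.diag_nonneg (i := i)
  have h3 := hYX.diag_nonneg (i := j)
  rw [sub_apply] at h2 h3
  rw [Set.mem_Icc, ← abs_le]
  linarith

/-- Symmetric matrices close to the identity are positive definite. -/
theorem eventually_posDef_of_tendsto_one {n : ℕ} {ι : Type*} {l : Filter ι}
    {N : ι → Matrix (Fin n) (Fin n) ℝ} (hN : Tendsto N l (𝓝 1)) (hs : ∀ i, (N i)ᵀ = N i) :
    ∀ᶠ i in l, (N i).PosDef := by
  -- Entries below ε perturb the form by at most εn|x|², and εn < 1; the n + 1 covers n = 0.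
  set ε : ℝ := 1 / (2 * (n + 1)) with hε
  have hε0 : 0 < ε := by positivity
  have hE : ∀ a b, ∀ᶠ i in l, |(N i - 1) a b| < ε := by
    intro a b
    have h1 : Tendsto (fun i => |(N i - 1) a b|) l (𝓝 |((1 : Matrix (Fin n) (Fin n) ℝ) - 1) a b|) :=
      (((hN.sub_const 1).apply_nhds a).apply_nhds b).abs
    refine h1.eventually_lt_const ?_
    simpa using hε0
  filter_upwards [eventually_all.2 fun a => eventually_all.2 fun b => hE a b] with i hi
  refine PosDef.of_dotProduct_mulVec_pos
    (by rw [IsHermitian, conjTranspose_eq_transpose_of_trivial, hs]) fun x hx => ?_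
  have hxx : 0 < x ⬝ᵥ x := by
    refine lt_of_le_of_ne (Finset.sum_nonneg fun a _ => mul_self_nonneg _) fun h => hx ?_
    exact dotProduct_self_eq_zero.1 h.symm
  have hsplit : x ⬝ᵥ N i *ᵥ x = x ⬝ᵥ x + x ⬝ᵥ (N i - 1) *ᵥ x := by
    rw [sub_mulVec, one_mulVec, dotProduct_sub]; ring
  have hb : -(ε * n * (x ⬝ᵥ x)) ≤ x ⬝ᵥ (N i - 1) *ᵥ x := by
    have h1 : ∀ a b, -(ε * ((x a * x a + x b * x b) / 2)) ≤ x a * ((N i - 1) a b * x b) := by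
      intro a b
      have h2 : |x a * ((N i - 1) a b * x b)| ≤ ε * ((x a * x a + x b * x b) / 2) := by
        rw [show x a * ((N i - 1) a b * x b) = (N i - 1) a b * (x a * x b) by ring, abs_mul]
        refine mul_le_mul (hi a b).le ?_ (abs_nonneg _) hε0.le
        rw [abs_le]
        constructor <;> nlinarith [sq_nonneg (x a + x b), sq_nonneg (x a - x b)]
      exact (abs_le.1 h2).1
    calc -(ε * n * (x ⬝ᵥ x)) = ∑ a, ∑ b, -(ε * ((x a * x a + x b * x b) / 2)) := by
          simp only [Finset.sum_neg_distrib, ← Finset.mul_sum, ← Finset.sum_div,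
            Finset.sum_add_distrib, Finset.sum_const, Finset.card_univ, Fintype.card_fin,
            dotProduct, nsmul_eq_mul]
          ring_nf
          rw [← Finset.mul_sum]
          ring
      _ ≤ ∑ a, ∑ b, x a * ((N i - 1) a b * x b) :=
          Finset.sum_le_sum fun a _ => Finset.sum_le_sum fun b _ => h1 a b
      _ = _ := by simp only [dotProduct, mulVec, Finset.mul_sum]
  have hεn : ε * n < 1 := by
    rw [hε, one_div, inv_mul_lt_iff₀ (by positivity)]
    linarith [(Nat.cast_nonneg n : (0 : ℝ) ≤ n)]
  rw [star_trivial, hsplit]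
  nlinarith

end Matrix

/-! ### A Hurwitz test from Lyapunov equations. -/

namespace LQR

open Matrix

section Lyapunov

variable {n : ℕ} {F G X W : Matrix (Fin n) (Fin n) ℝ}

/-- If a Lyapunov equation with positive semidefinite data holds for `F`, and `F` agrees with a
Hurwitz matrix on the null vectors of the right-hand side, then `F` is Hurwitz. -/
theorem isHurwitz_of_lyapunov (hX : X.PosSemidef) (hW : W.PosSemidef)
    (h : Fᵀ * X + X * F + W = 0) (hG : IsHurwitz G)
    (hFG : ∀ v, v ⬝ᵥ W *ᵥ v = 0 → F *ᵥ v = G *ᵥ v) : IsHurwitz F := by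
  rw [isHurwitz_iff]
  intro α β a b ha hb hα
  obtain ⟨hXs, hXq⟩ := posSemidef_iff_real.1 hX
  obtain ⟨-, hWq⟩ := posSemidef_iff_real.1 hW
  have hsymm : ∀ u v, u ⬝ᵥ X *ᵥ v = v ⬝ᵥ X *ᵥ u := fun u v => by
    rw [dotProduct_mulVec, ← mulVec_transpose, hXs, dotProduct_comm]
  have hv : ∀ v, 2 * (F *ᵥ v ⬝ᵥ X *ᵥ v) + v ⬝ᵥ W *ᵥ v = 0 := fun v => by
    have h1 : v ⬝ᵥ (Fᵀ * X + X * F + W) *ᵥ v = 0 := by rw [h, zero_mulVec, dotProduct_zero]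
    rw [add_mulVec, add_mulVec, dotProduct_add, dotProduct_add, ← mulVec_mulVec, ← mulVec_mulVec,
      hsymm v, dotProduct_mulVec v, vecMul_transpose] at h1
    linarith
  have h1 := hv a
  have h2 := hv b
  rw [ha, sub_dotProduct, smul_dotProduct, smul_dotProduct] at h1
  rw [hb, add_dotProduct, smul_dotProduct, smul_dotProduct, hsymm a] at h2
  simp only [smul_eq_mul] at h1 h2
  -- In the sum of `h1` and `h2` the β terms cancel, leaving nonnegative terms with sum zero, so
  -- both W-terms vanish.
  have h3 := mul_nonneg hα (hXq a)
  have h4 := mul_nonneg hα (hXq b)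
  have h5 := hWq a
  have h6 := hWq b
  refine isHurwitz_iff.1 hG α β a b ?_ ?_ hα
  · rw [← ha, hFG a (by linarith)]
  · rw [← hb, hFG b (by linarith)]

end Lyapunov

/-! ### Riccati equation: existence, maximality, continuity. -/

section Riccati

variable {n m : ℕ} {A : Matrix (Fin n) (Fin n) ℝ} {B : Matrix (Fin n) (Fin m) ℝ}
  {Q : Matrix (Fin n) (Fin n) ℝ} {R : Matrix (Fin m) (Fin m) ℝ}

/-- Completion of squares relating the Lyapunov equation of a feedback gain `K` and the Riccati
equation. -/
theorem lyapunov_eq_riccati_add_sq (hR : R.PosDef) {X : Matrix (Fin n) (Fin n) ℝ} (hX : Xᵀ = X)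
    (K : Matrix (Fin m) (Fin n) ℝ) :
    (A - B * K)ᵀ * X + X * (A - B * K) + (Q + Kᵀ * R * K) =
      (Aᵀ * X + X * A - X * B * R⁻¹ * Bᵀ * X + Q) +
        (K - R⁻¹ * Bᵀ * X)ᵀ * R * (K - R⁻¹ * Bᵀ * X) := by
  have hu : IsUnit R.det := (isUnit_iff_isUnit_det R).1 hR.isUnit
  have hRs : Rᵀ = R := (posSemidef_iff_real.1 hR.posSemidef).1
  have h1 : R * (R⁻¹ * Bᵀ * X) = Bᵀ * X := by
    rw [Matrix.mul_assoc, ← Matrix.mul_assoc R, mul_nonsing_inv _ hu, Matrix.one_mul]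
  have h2 : (R⁻¹ * Bᵀ * X)ᵀ * R = X * B := by
    have := congrArg transpose h1
    rwa [transpose_mul, transpose_mul Bᵀ, transpose_transpose, hRs, hX] at this
  have h3 : (K - R⁻¹ * Bᵀ * X)ᵀ * R * (K - R⁻¹ * Bᵀ * X) =
      Kᵀ * R * K - X * B * K - Kᵀ * (Bᵀ * X) + X * B * (R⁻¹ * Bᵀ * X) := by
    rw [transpose_sub, Matrix.sub_mul, Matrix.sub_mul, Matrix.mul_sub, Matrix.mul_sub, h2,
      Matrix.mul_assoc Kᵀ R (_ * X), h1]
    abel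
  rw [h3, transpose_sub, transpose_mul]
  simp only [Matrix.sub_mul, Matrix.mul_sub, Matrix.mul_assoc]
  abel

/-- At its own gain the square vanishes, so the two equations can be exchanged. -/
theorem lyapunov_gain_eq_riccati (hR : R.PosDef) {X : Matrix (Fin n) (Fin n) ℝ} (hX : Xᵀ = X) :
    (A - B * (R⁻¹ * Bᵀ * X))ᵀ * X + X * (A - B * (R⁻¹ * Bᵀ * X)) +
        (Q + (R⁻¹ * Bᵀ * X)ᵀ * R * (R⁻¹ * Bᵀ * X)) =
      Aᵀ * X + X * A - X * B * R⁻¹ * Bᵀ * X + Q := by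
  rw [lyapunov_eq_riccati_add_sq hR hX, sub_self, Matrix.mul_zero, add_zero]

/-- A stabilizing gain whose cost matrix inequality is solved by `Y` bounds every symmetric
solution of the Riccati equation. -/
theorem posSemidef_sub_of_solvesCARE (hR : R.PosDef) {K : Matrix (Fin m) (Fin n) ℝ}
    (hF : IsHurwitz (A - B * K)) {X Y : Matrix (Fin n) (Fin n) ℝ} (hX : Xᵀ = X)
    (hXs : SolvesCARE A B Q R X)
    (hY : (-((A - B * K)ᵀ * Y + Y * (A - B * K) + (Q + Kᵀ * R * K))).PosSemidef) :
    (Y - X).PosSemidef := by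
  refine hF.posSemidef_of_lyapunov ?_
  have h := lyapunov_eq_riccati_add_sq (A := A) (B := B) (Q := Q) hR hX K
  rw [show _ = _ from hXs, zero_add] at h
  have h2 := hY.add (hR.posSemidef.transpose_mul_mul_same (K - R⁻¹ * Bᵀ * X))
  rw [← h] at h2
  convert h2 using 1
  rw [mul_sub, sub_mul]
  abel

/-- One step of policy iteration. -/
theorem policy_iteration_step (hR : R.PosDef) (hQ : Q.PosSemidef) {K : Matrix (Fin m) (Fin n) ℝ}
    (hF : IsHurwitz (A - B * K)) {P : Matrix (Fin n) (Fin n) ℝ} (hP : P.PosSemidef)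
    (h : (A - B * K)ᵀ * P + P * (A - B * K) + (Q + Kᵀ * R * K) = 0) :
    IsHurwitz (A - B * (R⁻¹ * Bᵀ * P)) ∧ ∃ P' : Matrix (Fin n) (Fin n) ℝ, P'.PosSemidef ∧
      (P - P').PosSemidef ∧
      (A - B * (R⁻¹ * Bᵀ * P))ᵀ * P' + P' * (A - B * (R⁻¹ * Bᵀ * P)) +
        (Q + (R⁻¹ * Bᵀ * P)ᵀ * R * (R⁻¹ * Bᵀ * P)) = 0 := by
  have hPs := (posSemidef_iff_real.1 hP).1
  have h1 := lyapunov_eq_riccati_add_sq (A := A) (B := B) (Q := Q) hR hPs K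
  have h2 := lyapunov_gain_eq_riccati (A := A) (B := B) (Q := Q) hR hPs
  rw [h] at h1
  set K' := R⁻¹ * Bᵀ * P with hK'
  set D := (K - K')ᵀ * R * (K - K') with hD
  have hDp : D.PosSemidef := hR.posSemidef.transpose_mul_mul_same _
  have hW' : (Q + K'ᵀ * R * K').PosSemidef := hQ.add (hR.posSemidef.transpose_mul_mul_same _)
  have h3 : (A - B * K')ᵀ * P + P * (A - B * K') + (Q + K'ᵀ * R * K' + D) = 0 := by
    rw [← add_assoc, h2, ← h1]
  have hF' : IsHurwitz (A - B * K') := by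
    -- On null vectors of D the two gains agree, since R is definite, so the new closed loop acts
    -- there as the old Hurwitz one.
    refine isHurwitz_of_lyapunov hP (hW'.add hDp) h3 hF fun v hv => ?_
    have hv1 := (posSemidef_iff_real.1 hW').2 v
    have hv2 := (posSemidef_iff_real.1 hDp).2 v
    rw [add_mulVec, dotProduct_add] at hv
    have hv3 : v ⬝ᵥ D *ᵥ v = 0 := by linarith
    have hv4 : (K - K') *ᵥ v = 0 := by
      by_contra hne
      have := hR.dotProduct_mulVec_pos hne
      rw [star_trivial] at this
      rw [hD, ← mulVec_mulVec, ← mulVec_mulVec, dotProduct_mulVec, vecMul_transpose] at hv3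
      linarith
    rw [sub_mulVec, sub_eq_zero] at hv4
    rw [sub_mulVec, sub_mulVec, ← mulVec_mulVec v B, ← mulVec_mulVec v B, hv4]
  refine ⟨hF', ?_⟩
  obtain ⟨P', hP', hL⟩ := hF'.exists_lyapunov hW'
  refine ⟨P', hP', hF'.posSemidef_of_lyapunov ?_, hL⟩
  convert hDp using 1
  rw [neg_eq_iff_add_eq_zero, ← sub_eq_zero.2 (h3.trans hL.symm), mul_sub, sub_mul]
  abel

/-- Stabilizability yields a positive semidefinite solution of the Riccati equation. -/
theorem Stabilizable.exists_solvesCARE (hst : Stabilizable A B) (hR : R.PosDef)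
    (hQ : Q.PosSemidef) :
    ∃ P : Matrix (Fin n) (Fin n) ℝ, P.PosSemidef ∧ SolvesCARE A B Q R P := by
  obtain ⟨K, hK⟩ := hst
  obtain ⟨P₀, hP₀, hL₀⟩ := hK.exists_lyapunov
    (hQ.add (hR.posSemidef.transpose_mul_mul_same K))
  -- Iterates carry a stabilizing gain, so the step can be repeated.
  let T := {P : Matrix (Fin n) (Fin n) ℝ // P.PosSemidef ∧ ∃ K : Matrix (Fin m) (Fin n) ℝ,
    IsHurwitz (A - B * K) ∧ (A - B * K)ᵀ * P + P * (A - B * K) + (Q + Kᵀ * R * K) = 0}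
  have hnext : ∀ P : T, ∃ P' : T, (P.1 - P'.1).PosSemidef ∧
      (A - B * (R⁻¹ * Bᵀ * P.1))ᵀ * P'.1 + P'.1 * (A - B * (R⁻¹ * Bᵀ * P.1)) +
        (Q + (R⁻¹ * Bᵀ * P.1)ᵀ * R * (R⁻¹ * Bᵀ * P.1)) = 0 := by
    rintro ⟨P, hP, K, hK, hL⟩
    obtain ⟨hH, P', hP', hPP', hL'⟩ := policy_iteration_step hR hQ hK hP hL
    exact ⟨⟨P', hP', _, hH, hL'⟩, hPP', hL'⟩
  choose next hnext using hnext
  let X : ℕ → T := fun k => next^[k] ⟨P₀, hP₀, K, hK, hL₀⟩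
  have hX : ∀ k, X (k + 1) = next (X k) := fun k => Function.iterate_succ_apply' _ _ _
  obtain ⟨P, hlim⟩ := exists_tendsto_of_posSemidef_sub_succ (X := fun k => (X k).1)
    (fun k => (X k).2.1) (fun k => by simpa only [hX] using (hnext (X k)).1)
  have hP : P.PosSemidef := isClosed_setOf_posSemidef.mem_of_tendsto hlim
    (Eventually.of_forall fun k => (X k).2.1)
  refine ⟨P, hP, ?_⟩
  have hc : Continuous fun p : Matrix (Fin n) (Fin n) ℝ × Matrix (Fin n) (Fin n) ℝ =>
      (A - B * (R⁻¹ * Bᵀ * p.1))ᵀ * p.2 + p.2 * (A - B * (R⁻¹ * Bᵀ * p.1)) +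
        (Q + (R⁻¹ * Bᵀ * p.1)ᵀ * R * (R⁻¹ * Bᵀ * p.1)) := by fun_prop
  -- Consecutive iterates share the limit P, so the recursion becomes the Lyapunov equation of P's
  -- own gain, which is the Riccati equation.
  have hl := (hc.tendsto (P, P)).comp (hlim.prodMk_nhds ((tendsto_add_atTop_iff_nat 1).2 hlim))
  have hzero := tendsto_nhds_unique (hl.congr fun k => by
    simpa only [Function.comp, hX] using (hnext (X k)).2) tendsto_const_nhds
  have h2 := lyapunov_gain_eq_riccati (A := A) (B := B) (Q := Q) hR
    (posSemidef_iff_real.1 hP).1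
  exact h2.symm.trans hzero

/-- Under detectability every positive semidefinite solution of the Riccati equation is
stabilizing. -/
theorem Detectable.isHurwitz_of_solvesCARE (hdet : Detectable A (CFC.sqrt Q)) (hR : R.PosDef)
    (hQ : Q.PosSemidef) {P : Matrix (Fin n) (Fin n) ℝ} (hP : P.PosSemidef)
    (h : SolvesCARE A B Q R P) : IsHurwitz (A - B * (R⁻¹ * Bᵀ * P)) := by
  obtain ⟨L, hL⟩ := hdet
  have h2 := lyapunov_gain_eq_riccati (A := A) (B := B) (Q := Q) hR
    (posSemidef_iff_real.1 hP).1
  rw [show _ = _ from h] at h2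
  set K := R⁻¹ * Bᵀ * P
  have hKp : (Kᵀ * R * K).PosSemidef := hR.posSemidef.transpose_mul_mul_same _
  -- A null vector v satisfies Kv = 0 and √Q v = 0, so A - BK and A - L√Q both act on it as A.
  refine isHurwitz_of_lyapunov hP (hQ.add hKp) h2 hL fun v hv => ?_
  rw [add_mulVec, dotProduct_add] at hv
  have hv1 := (posSemidef_iff_real.1 hQ).2 v
  have hv2 := (posSemidef_iff_real.1 hKp).2 v
  have hQv : v ⬝ᵥ Q *ᵥ v = 0 := by linarith
  have hKv : v ⬝ᵥ (Kᵀ * R * K) *ᵥ v = 0 := by linarith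
  have hK0 : K *ᵥ v = 0 := by
    by_contra hne
    have := hR.dotProduct_mulVec_pos hne
    rw [star_trivial] at this
    rw [← mulVec_mulVec, ← mulVec_mulVec, dotProduct_mulVec, vecMul_transpose] at hKv
    linarith
  have hS0 : CFC.sqrt Q *ᵥ v = 0 := by
    have hs : (CFC.sqrt Q)ᵀ = CFC.sqrt Q :=
      (posSemidef_iff_real.1 (nonneg_iff_posSemidef.1 (CFC.sqrt_nonneg Q))).1
    rw [← CFC.sqrt_mul_sqrt_self Q (nonneg_iff_posSemidef.2 hQ), ← mulVec_mulVec,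
      dotProduct_mulVec, ← mulVec_transpose, hs] at hQv
    exact dotProduct_self_eq_zero.1 hQv
  rw [sub_mulVec, sub_mulVec, ← mulVec_mulVec v B, ← mulVec_mulVec v L, hK0, hS0, mulVec_zero,
    mulVec_zero]

/-- Under detectability a positive semidefinite solution of the Riccati equation dominates every
symmetric solution. -/
theorem Detectable.posSemidef_sub (hdet : Detectable A (CFC.sqrt Q)) (hR : R.PosDef)
    (hQ : Q.PosSemidef) {P X : Matrix (Fin n) (Fin n) ℝ} (hP : P.PosSemidef)
    (h : SolvesCARE A B Q R P) (hX : Xᵀ = X) (hXs : SolvesCARE A B Q R X) :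
    (P - X).PosSemidef := by
  refine posSemidef_sub_of_solvesCARE hR (hdet.isHurwitz_of_solvesCARE hR hQ hP h) hX hXs ?_
  rw [lyapunov_gain_eq_riccati hR (posSemidef_iff_real.1 hP).1, show _ = _ from h, neg_zero]
  exact PosSemidef.zero

/-- Each of the two solutions dominates the other. -/
theorem Detectable.eq_of_solvesCARE (hdet : Detectable A (CFC.sqrt Q)) (hR : R.PosDef)
    (hQ : Q.PosSemidef) {P X : Matrix (Fin n) (Fin n) ℝ} (hP : P.PosSemidef)
    (h : SolvesCARE A B Q R P) (hX : X.PosSemidef) (hXs : SolvesCARE A B Q R X) : X = P :=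
  le_antisymm (Matrix.le_iff.2 (hdet.posSemidef_sub hR hQ hP h (posSemidef_iff_real.1 hX).1 hXs))
    (Matrix.le_iff.2 (hdet.posSemidef_sub hR hQ hX hXs (posSemidef_iff_real.1 hP).1 h))

/-- The positive semidefinite solution of the Riccati equation depends continuously on the
system matrix. -/
theorem tendsto_of_solvesCARE (hst : Stabilizable A B) (hdet : Detectable A (CFC.sqrt Q))
    (hR : R.PosDef) (hQ : Q.PosSemidef) {P : Matrix (Fin n) (Fin n) ℝ} (hP : P.PosSemidef)
    (h : SolvesCARE A B Q R P) {ι : Type*} {l : Filter ι} {A' P' : ι → Matrix (Fin n) (Fin n) ℝ}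
    (hA' : Tendsto A' l (𝓝 A)) (hP' : ∀ᶠ i in l, (P' i).PosSemidef)
    (h' : ∀ᶠ i in l, SolvesCARE (A' i) B Q R (P' i)) : Tendsto P' l (𝓝 P) := by
  obtain ⟨K, hK⟩ := hst
  have hW : (Q + Kᵀ * R * K).PosSemidef := hQ.add (hR.posSemidef.transpose_mul_mul_same K)
  have hWs := (posSemidef_iff_real.1 hW).1
  -- The added identity is the slack that absorbs the perturbation of A.
  obtain ⟨Y, hY, hL⟩ := hK.exists_lyapunov (hW.add PosSemidef.one)
  have hYs := (posSemidef_iff_real.1 hY).1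
  obtain ⟨s, hs, hsmem⟩ := exists_isCompact_of_posSemidef_le Y
  have hc : Continuous fun C : Matrix (Fin n) (Fin n) ℝ =>
      -((C - B * K)ᵀ * Y + Y * (C - B * K) + (Q + Kᵀ * R * K)) := by fun_prop
  have hN := (hc.tendsto A).comp hA'
  rw [show -((A - B * K)ᵀ * Y + Y * (A - B * K) + (Q + Kᵀ * R * K)) = 1 by
    rw [neg_eq_iff_add_eq_zero, add_assoc, hL]] at hN
  have hpd := eventually_posDef_of_tendsto_one hN fun i => by
    simp only [Function.comp, transpose_neg, transpose_add (_ + _) (Q + _), hWs]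
    rw [transpose_add, transpose_mul, transpose_mul, transpose_transpose, hYs, add_comm (Y * _)]
  have hmem : ∀ᶠ i in l, P' i ∈ s := by
    filter_upwards [hP', h', hpd] with i hPi hi hpi
    refine hsmem _ hPi (posSemidef_sub_of_solvesCARE hR ?_ (posSemidef_iff_real.1 hPi).1 hi
      hpi.posSemidef)
    -- K also stabilizes the perturbed system: the right-hand side is definite, so its only null
    -- vector is 0.
    refine isHurwitz_of_lyapunov hY (hW.add hpi.posSemidef) ?_ hK fun v hv => ?_
    · simp only [Function.comp]
      abel
    · have hv0 : v = 0 := by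
        by_contra hne
        have h1 := hpi.dotProduct_mulVec_pos hne
        have h2 := (posSemidef_iff_real.1 hW).2 v
        rw [star_trivial] at h1
        rw [add_mulVec, dotProduct_add] at hv
        linarith
      rw [hv0, mulVec_zero, mulVec_zero]
  -- In a compact set it suffices that P is the only cluster point; the Riccati equation passes to
  -- limits along an ultrafilter.
  refine hs.tendsto_nhds_of_unique_mapClusterPt hmem fun Z _ hZ => ?_
  obtain ⟨U, hU, hUZ⟩ := mapClusterPt_iff_ultrafilter.1 hZ
  refine hdet.eq_of_solvesCARE hR hQ hP h
    (isClosed_setOf_posSemidef.mem_of_tendsto hUZ (hU hP')) ?_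
  have hc2 : Continuous fun p : Matrix (Fin n) (Fin n) ℝ × Matrix (Fin n) (Fin n) ℝ =>
      p.1ᵀ * p.2 + p.2 * p.1 - p.2 * B * R⁻¹ * Bᵀ * p.2 + Q := by fun_prop
  have hl := (hc2.tendsto (A, Z)).comp ((hA'.mono_left hU).prodMk_nhds hUZ)
  have hzero : ∀ᶠ i in (U : Filter ι), SolvesCARE (A' i) B Q R (P' i) := hU h'
  exact tendsto_nhds_unique hl (tendsto_const_nhds.congr' (hzero.mono fun i hi => Eq.symm hi))

theorem Stabilizable.careSolution_spec (hst : Stabilizable A B) (hR : R.PosDef)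
    (hQ : Q.PosSemidef) :
    (careSolution A B Q R).PosSemidef ∧ SolvesCARE A B Q R (careSolution A B Q R) := by
  have h := hst.exists_solvesCARE hR hQ
  rw [careSolution, dif_pos h]
  exact h.choose_spec

end Riccati

theorem continuous_systemMatrix {n p : ℕ} (A₀ : Matrix (Fin n) (Fin n) ℝ)
    (A₁ : Fin p → Matrix (Fin n) (Fin n) ℝ) : Continuous (systemMatrix A₀ A₁) := by
  unfold systemMatrix
  fun_prop

end LQR

theorem mainTheorem6 {n m p : ℕ}
    (A₀ : Matrix (Fin n) (Fin n) ℝ) (A₁ : Fin p → Matrix (Fin n) (Fin n) ℝ)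
    (B : Matrix (Fin n) (Fin m) ℝ)
    (Q : Matrix (Fin n) (Fin n) ℝ) (R : Matrix (Fin m) (Fin m) ℝ)
    (S : Set (EuclideanSpace ℝ (Fin p)))
    (hS : LQR.IsPolytope S) (hSne : S.Nonempty)
    (hR : R.PosDef) (hQ : Q.PosSemidef)
    (hstab : ∀ ρ ∈ S, LQR.Stabilizable (LQR.systemMatrix A₀ A₁ ρ) B)
    (hdet : ∀ ρ ∈ S, LQR.Detectable (LQR.systemMatrix A₀ A₁ ρ) (CFC.sqrt Q)) :
    -- `P*(ρ)` is well defined: it is the unique positive semidefinite solution of the Riccati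
    -- equation, and the maximal one among all symmetric solutions
    (∀ ρ ∈ S,
      (LQR.careSolution (LQR.systemMatrix A₀ A₁ ρ) B Q R).PosSemidef ∧
      LQR.SolvesCARE (LQR.systemMatrix A₀ A₁ ρ) B Q R
        (LQR.careSolution (LQR.systemMatrix A₀ A₁ ρ) B Q R) ∧
      (∀ X : Matrix (Fin n) (Fin n) ℝ, X.PosSemidef →
        LQR.SolvesCARE (LQR.systemMatrix A₀ A₁ ρ) B Q R X →
        X = LQR.careSolution (LQR.systemMatrix A₀ A₁ ρ) B Q R) ∧
      (∀ X : Matrix (Fin n) (Fin n) ℝ, X.IsSymm →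
        LQR.SolvesCARE (LQR.systemMatrix A₀ A₁ ρ) B Q R X →
        (LQR.careSolution (LQR.systemMatrix A₀ A₁ ρ) B Q R - X).PosSemidef)) ∧
    ContinuousOn (fun ρ => LQR.optimalGain (LQR.systemMatrix A₀ A₁ ρ) B Q R) S ∧
    IsCompact ((fun ρ => LQR.optimalGain (LQR.systemMatrix A₀ A₁ ρ) B Q R) '' S) ∧
    IsPathConnected ((fun ρ => LQR.optimalGain (LQR.systemMatrix A₀ A₁ ρ) B Q R) '' S) := by
  have hspec := fun ρ hρ => (hstab ρ hρ).careSolution_spec hR hQ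
  have hcont : ContinuousOn (fun ρ => LQR.optimalGain (LQR.systemMatrix A₀ A₁ ρ) B Q R) S := by
    intro ρ hρ
    have hP : Tendsto (fun ρ => LQR.careSolution (LQR.systemMatrix A₀ A₁ ρ) B Q R) (𝓝[S] ρ)
        (𝓝 (LQR.careSolution (LQR.systemMatrix A₀ A₁ ρ) B Q R)) :=
      LQR.tendsto_of_solvesCARE (hstab ρ hρ) (hdet ρ hρ) hR hQ (hspec ρ hρ).1 (hspec ρ hρ).2
        ((LQR.continuous_systemMatrix A₀ A₁).continuousWithinAt)
        (eventually_mem_nhdsWithin.mono fun σ hσ => (hspec σ hσ).1)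
        (eventually_mem_nhdsWithin.mono fun σ hσ => (hspec σ hσ).2)
    have hc : Continuous fun P : Matrix (Fin n) (Fin n) ℝ => R⁻¹ * Bᵀ * P := by fun_prop
    exact (hc.tendsto _).comp hP
  obtain ⟨V, hV, rfl⟩ := hS
  refine ⟨fun ρ hρ => ⟨(hspec ρ hρ).1, (hspec ρ hρ).2, fun X hX hXs => ?_, fun X hX hXs => ?_⟩,
    hcont, (hV.isCompact_convexHull ℝ).image_of_continuousOn hcont, ?_⟩
  · exact (hdet ρ hρ).eq_of_solvesCARE hR hQ (hspec ρ hρ).1 (hspec ρ hρ).2 hX hXs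
  · exact (hdet ρ hρ).posSemidef_sub hR hQ (hspec ρ hρ).1 (hspec ρ hρ).2 hX hXs
  · exact ((convex_convexHull ℝ V).isPathConnected hSne).image' hcont
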